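/- Let $\delta\in(0,1)$. Put $s_0^{(\delta)}=\left(\tfrac12\right)^{\delta}$, $s_1^{(\delta)}=\left(\tfrac32\right)^{\delta}-2\left(\tfrac12\right)^{\delta}$ and $s_k^{(\delta)}=\left(k+\tfrac12\right)^{\delta}-2\left(k-\tfrac12\right)^{\delta}+\left(k-\tfrac32\right)^{\delta}$ for $k\ge 2$; put $q_0^{(\delta)}=-s_0^{(\delta)}$ and $q_k^{(\delta)}=s_{k-1}^{(\delta)}-s_k^{(\delta)}$ for $k\ge 1$. For $n\ge 1$ let $T_n^{\delta}\in\mathbb{R}^{n\times n}$ be the Toeplitz matrix with entries $(T_n^{\delta})_{ij}=q_{i-j+1}^{(\delta)}$ if $j\le i+1$ and $(T_n^{\delta})_{ij}=0$ otherwise. Then the series $$g_\delta(\theta)=\sum_{j=0}^{\infty}q_j^{(\delta)}e^{\mathbf{i}(j-1)\theta}$$ converges absolutely for every $\theta\in\mathbb{R}$, and $g_\delta$ is the generating function of the matrices $T_n^{\delta}$; that is, $g_\delta(\theta)=\sum_{k\in\mathbb{Z}}t_k e^{\mathbf{i}k\theta}$ for every $\theta\in\mathbb{R}$, where $(T_n^{\delta})_{ij}=t_{i-j}$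 for all $n\geq 1$ and $1\le i,j\le n$. Moreover, for every $\theta\in\mathbb{R}\setminus\{2k\pi\mid k\in\mathbb{Z}\}$: (i) $\operatorname{Re}(g_\delta(\theta))>0$; (ii) $\dfrac{|\operatorname{Im}(g_\delta(\theta))|}{\operatorname{Re}(g_\delta(\theta))}<\tan\left(\dfrac{\delta}{2}\pi\right)$. -/

import Mathlib

open Real

noncomputable section

namespace FVToeplitz

/-- The numbers `s_k^{(δ)}`: second differences of `x ↦ x ^ δ` at half-integers, with the two
boundary values at `k = 0` and `k = 1`. All bases of the real powers are positive. -/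
def s (δ : ℝ) : ℕ → ℝ
  | 0 => (1 / 2 : ℝ) ^ δ
  | 1 => (3 / 2 : ℝ) ^ δ - 2 * (1 / 2 : ℝ) ^ δ
  | k + 2 => (((k + 2 : ℕ) : ℝ) + 1 / 2) ^ δ - 2 * (((k + 2 : ℕ) : ℝ) - 1 / 2) ^ δ
      + (((k + 2 : ℕ) : ℝ) - 3 / 2) ^ δ

/-- The coefficients `q_k^{(δ)}`: `q_0 = -s_0` and `q_k = s_{k-1} - s_k` for `k ≥ 1`. -/
def q (δ : ℝ) : ℕ → ℝ
  | 0 => -s δ 0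
  | k + 1 => s δ k - s δ (k + 1)

/-- The finite-volume matrix `T_n^δ`: a lower Hessenberg Toeplitz matrix of order `n` with `q_0` on
the superdiagonal, `q_1` on the diagonal, and `q_{m+1}` on the `m`-th subdiagonal. -/
def T (δ : ℝ) (n : ℕ) : Matrix (Fin n) (Fin n) ℝ :=
  Matrix.of fun i j => if (j : ℕ) ≤ (i : ℕ) + 1 then q δ ((i : ℕ) + 1 - (j : ℕ)) else 0

/-- `f` is the generating function of the sequence of Toeplitz matrices `A n`: there are numbers
`t k` (`k` an integer) with `A n = [t (i - j)]` for every `n`, and `f θ = ∑ₖ t k * exp (I * k * θ)`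
with an (unconditionally, hence absolutely) convergent sum for every real `θ`. The matrices
determine every `t k`, so they determine `f`. -/
def IsGeneratingFunction (A : (n : ℕ) → Matrix (Fin n) (Fin n) ℝ) (f : ℝ → ℂ) : Prop :=
  ∃ t : ℤ → ℝ,
    (∀ (n : ℕ) (i j : Fin n), A n i j = t (((i : ℕ) : ℤ) - ((j : ℕ) : ℤ))) ∧
    ∀ θ : ℝ, HasSum (fun k : ℤ => (t k : ℂ) * Complex.exp (Complex.I * (k : ℂ) * (θ : ℂ))) (f θ)

/-- The function `g_δ(θ) = ∑_{j ≥ 0} q_j^{(δ)} exp (I * (j - 1) * θ)`. -/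
def g (δ : ℝ) (θ : ℝ) : ℂ :=
  ∑' j : ℕ, (q δ j : ℂ) * Complex.exp (Complex.I * ((j : ℂ) - 1) * (θ : ℂ))

end FVToeplitz

end

/-!
Write `z = exp (iθ)` and `A(z) = ∑ (k + 1 / 2) ^ δ z ^ k`. The numbers `q_k` are minus the third
backward differences of `(k + 1 / 2) ^ δ`, so that `g_δ(θ) = -z⁻¹ (1 - z) ^ 3 A(z)` formally on the
unit circle and rigorously inside the disc (`tsum_q_mul_pow`).

For `0 < Re w`, Poisson summation for the damped truncated power `x₊ ^ δ exp (-w x)`, whose Fourier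
transform is `Γ(δ + 1) (w + 2πiy) ^ (-1 - δ)`, evaluated at the half-integers turns `A(exp (-w))`
into `exp (w / 2) Γ(δ + 1) ∑ₙ (-1) ^ n (w + 2πin) ^ (-1 - δ)` (`tsum_dampedPow`). The dual series
still converges absolutely on the imaginary axis away from `2πiℤ`, and so does the power series of
`q` (`summable_q`), so the identity passes to `w = iφ` with `0 < φ < 2π`
(`tsum_q_mul_exp_boundary`). There the terms with `n ≥ 0` all have, up to the alternating sign, the
same phase, and so do those with `n < 0`. This gives (`g_neg_eq`)

`g_δ(-φ) = 8 sin³(φ / 2) Γ(δ + 1) (P(φ) exp (-iπδ / 2) + P(2π - φ) exp (iπδ / 2))`,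

where `P(y) = ∑ₘ (-1) ^ m (y + 2πm) ^ (-1 - δ)` is positive as an alternating series with
decreasing terms (`altSum_pos`). Hence the real part is positive, and
`|Im g_δ| / Re g_δ = tan (πδ / 2) |P(2π - φ) - P(φ)| / (P(φ) + P(2π - φ)) < tan (πδ / 2)`.
The remaining `θ` follow by periodicity.
-/

open Filter Topology MeasureTheory Set
open scoped FourierTransform

/-! ### Laplace transform of a power -/

/-- The Laplace transform of `t ^ δ` is analytic in the right half-plane. -/
lemma differentiableAt_integral_rpow_mul_exp {δ : ℝ} (hδ : -1 < δ) {w : ℂ} (hw : 0 < w.re) :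
    DifferentiableAt ℂ
      (fun w : ℂ ↦ ∫ t in Ioi (0 : ℝ), ((t ^ δ : ℝ) : ℂ) * Complex.exp (-w * t)) w := by
  have hint (b p : ℝ) (hb : 0 < b) (hp : -1 < p) :
      IntegrableOn (fun t : ℝ ↦ t ^ p * rexp (-b * t)) (Ioi 0) := by
    simpa using integrableOn_rpow_mul_exp_neg_mul_rpow (p := 1) hp one_pos hb
  have hmeas (v : ℂ) : AEStronglyMeasurable
      (fun t : ℝ ↦ ((t ^ δ : ℝ) : ℂ) * Complex.exp (-v * t)) (volume.restrict (Ioi 0)) := by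
    apply Measurable.aestronglyMeasurable
    fun_prop
  have hnorm (v : ℂ) (t : ℝ) (ht : 0 < t) :
      ‖((t ^ δ : ℝ) : ℂ) * Complex.exp (-v * t)‖ = t ^ δ * rexp (-v.re * t) := by
    rw [norm_mul, Complex.norm_real, Complex.norm_exp, Real.norm_of_nonneg (by positivity)]
    simp
  refine (hasDerivAt_integral_of_dominated_loc_of_deriv_le
    (F := fun (v : ℂ) (t : ℝ) ↦ ((t ^ δ : ℝ) : ℂ) * Complex.exp (-v * t))
    (F' := fun (v : ℂ) (t : ℝ) ↦ ((t ^ δ : ℝ) : ℂ) * (Complex.exp (-v * t) * (-1 * t)))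
    (s := {v : ℂ | w.re / 2 < v.re}) (bound := fun t ↦ t ^ (δ + 1) * rexp (-(w.re / 2) * t))
    ?_ (.of_forall hmeas) ?_ ?_ ?_ (hint _ _ (by linarith) (by linarith)) ?_).2.differentiableAt
  · exact (isOpen_lt continuous_const Complex.continuous_re).mem_nhds
      (by simp only [mem_ofPred_eq]; linarith)
  · refine (hint w.re δ hw hδ).mono' (hmeas w) ?_
    filter_upwards [ae_restrict_mem measurableSet_Ioi] with t ht
    exact (hnorm w t ht).le
  · apply Measurable.aestronglyMeasurable
    fun_prop
  · filter_upwards [ae_restrict_mem measurableSet_Ioi] with t ht v hv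
    rw [mem_Ioi] at ht
    rw [← mul_assoc, norm_mul, hnorm v t ht, rpow_add_one ht.ne']
    have : ‖(-1 * t : ℂ)‖ = t := by simp [abs_of_pos ht]
    rw [this, mul_right_comm]
    have hv' : w.re / 2 < v.re := hv
    gcongr
  · refine .of_forall fun t v _ ↦ ?_
    refine HasDerivAt.const_mul _ (HasDerivAt.cexp ?_)
    exact (hasDerivAt_id v).neg.mul_const _

/-- The Laplace transform of `t ^ δ` at a complex point of the right half-plane; by analytic
continuation from the positive real axis. -/
lemma integral_rpow_mul_exp_neg_mul {δ : ℝ} (hδ : -1 < δ) {w : ℂ} (hw : 0 < w.re) :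
    ∫ t in Ioi (0 : ℝ), ((t ^ δ : ℝ) : ℂ) * Complex.exp (-w * t) =
      w ^ ((-1 - δ : ℝ) : ℂ) * Real.Gamma (δ + 1) := by
  have hopen : IsOpen {v : ℂ | 0 < v.re} := isOpen_lt continuous_const Complex.continuous_re
  have hreal (r : ℝ) (hr : 0 < r) :
      ∫ t in Ioi (0 : ℝ), ((t ^ δ : ℝ) : ℂ) * Complex.exp (-(r : ℂ) * t) =
        (r : ℂ) ^ ((-1 - δ : ℝ) : ℂ) * Real.Gamma (δ + 1) := by
    have h := Real.integral_rpow_mul_exp_neg_mul_Ioi (a := δ + 1) (by linarith) hr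
    rw [add_sub_cancel_right] at h
    rw [show (-1 - δ) = -(δ + 1) by ring, ← Complex.ofReal_cpow hr.le, rpow_neg hr.le,
      ← inv_rpow hr.le, ← one_div, ← Complex.ofReal_mul, ← h, ← integral_complex_ofReal]
    congr 1 with t
    push_cast
    ring_nf
  refine AnalyticOnNhd.eqOn_of_preconnected_of_frequently_eq (z₀ := 1)
    (f := fun w : ℂ ↦ ∫ t in Ioi (0 : ℝ), ((t ^ δ : ℝ) : ℂ) * Complex.exp (-w * t))
    (g := fun w : ℂ ↦ w ^ ((-1 - δ : ℝ) : ℂ) * Real.Gamma (δ + 1))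
    (DifferentiableOn.analyticOnNhd (fun v hv ↦
      (differentiableAt_integral_rpow_mul_exp hδ hv).differentiableWithinAt) hopen)
    (DifferentiableOn.analyticOnNhd (fun v hv ↦ ?_) hopen)
    (convex_halfSpace_re_gt 0).isPreconnected (show (0 : ℝ) < (1 : ℂ).re by norm_num) ?_ hw
  · refine DifferentiableAt.differentiableWithinAt (DifferentiableAt.mul_const ?_ _)
    exact differentiableAt_id.cpow_const (Or.inl hv)
  · have ht : Tendsto (fun x : ℝ ↦ (x : ℂ)) (𝓝[>] 1) (𝓝[≠] 1) := by
      refine tendsto_nhdsWithin_iff.2 ⟨?_, ?_⟩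
      · exact (Complex.continuous_ofReal.tendsto' 1 1 (by simp)).mono_left nhdsWithin_le_nhds
      · filter_upwards [self_mem_nhdsWithin] with x hx
        simpa using (ne_of_gt hx)
    refine ht.frequently (Eventually.frequently ?_)
    filter_upwards [self_mem_nhdsWithin] with x hx
    exact hreal x (zero_lt_one.trans hx)

/-! ### The coefficients `q` and their power series -/

/-- Backward difference of a sequence, extended by zero to the left of `0`. -/
def bdiff (f : ℕ → ℝ) : ℕ → ℝ
  | 0 => f 0
  | k + 1 => f (k + 1) - f k

/-- Taking backward differences multiplies the generating power series by `1 - z`. -/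
lemma HasSum.bdiff {f : ℕ → ℝ} {z S : ℂ} (h : HasSum (fun k ↦ (f k : ℂ) * z ^ k) S) :
    HasSum (fun k ↦ (_root_.bdiff f k : ℂ) * z ^ k) ((1 - z) * S) := by
  have h1 : HasSum (fun k ↦ (f (k + 1) : ℂ) * z ^ (k + 1)) (S - f 0) := by
    simpa using (hasSum_nat_add_iff' 1).2 h
  rw [← hasSum_nat_add_iff' 1]
  convert h1.sub (h.mul_left z) using 1
  · ext k
    simp only [_root_.bdiff]
    push_cast
    ring
  · simp [_root_.bdiff]
    ring

namespace FVToeplitz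

lemma q_eq_neg_bdiff (δ : ℝ) (k : ℕ) :
    q δ k = -bdiff (bdiff (bdiff fun j ↦ ((j : ℝ) + 1 / 2) ^ δ)) k := by
  have hs : s δ = bdiff (bdiff fun j ↦ ((j : ℝ) + 1 / 2) ^ δ) := by
    funext k
    match k with
    | 0 => simp [s, bdiff]
    | 1 =>
      simp only [s, bdiff]
      norm_num
      ring
    | k + 2 =>
      simp only [s, bdiff]
      push_cast
      ring_nf
  rw [← hs]
  cases k <;> simp [q, bdiff]

lemma s_nonpos {δ : ℝ} (hδ0 : 0 < δ) (hδ1 : δ < 1) (k : ℕ) : s δ (k + 2) ≤ 0 := by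
  have h := (Real.concaveOn_rpow hδ0.le hδ1.le).2
    (show (k : ℝ) + 5 / 2 ∈ Ici 0 from mem_Ici.2 (by positivity))
    (show (k : ℝ) + 1 / 2 ∈ Ici 0 from mem_Ici.2 (by positivity))
    (show (0 : ℝ) ≤ 1 / 2 by norm_num) (show (0 : ℝ) ≤ 1 / 2 by norm_num) (by norm_num)
  simp only [smul_eq_mul] at h
  rw [show 1 / 2 * ((k : ℝ) + 5 / 2) + 1 / 2 * ((k : ℝ) + 1 / 2) = k + 3 / 2 by ring] at h
  simp only [s]
  push_cast
  rw [show (k : ℝ) + 2 + 1 / 2 = k + 5 / 2 by ring, show (k : ℝ) + 2 - 1 / 2 = k + 3 / 2 by ring,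
    show (k : ℝ) + 2 - 3 / 2 = k + 1 / 2 by ring]
  linarith

/-- The second differences increase because the derivative of `x ^ δ` is midpoint convex. -/
lemma s_le_s_succ {δ : ℝ} (hδ0 : 0 < δ) (hδ1 : δ < 1) (k : ℕ) : s δ (k + 2) ≤ s δ (k + 3) := by
  let F : ℝ → ℝ := fun x ↦ (x + 2) ^ δ - 2 * (x + 1) ^ δ + x ^ δ
  have hd (x : ℝ) (hx : 0 < x) : HasDerivAt F
      (δ * ((x + 2) ^ (δ - 1) - 2 * (x + 1) ^ (δ - 1) + x ^ (δ - 1))) x := by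
    have h2 : HasDerivAt (fun x : ℝ ↦ (x + 2) ^ δ) (1 * δ * (x + 2) ^ (δ - 1)) x :=
      ((hasDerivAt_id' x).add_const 2).rpow_const (Or.inl (by positivity))
    have h1 : HasDerivAt (fun x : ℝ ↦ (x + 1) ^ δ) (1 * δ * (x + 1) ^ (δ - 1)) x :=
      ((hasDerivAt_id' x).add_const 1).rpow_const (Or.inl (by positivity))
    have h0 : HasDerivAt (fun x : ℝ ↦ x ^ δ) (1 * δ * x ^ (δ - 1)) x :=
      (hasDerivAt_id' x).rpow_const (Or.inl hx.ne')
    refine ((h2.sub (h1.const_mul 2)).add h0).congr_deriv ?_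
    ring
  have hmono : MonotoneOn F (Ioi 0) := by
    refine monotoneOn_of_deriv_nonneg (convex_Ioi 0)
      (fun x hx ↦ (hd x hx).continuousAt.continuousWithinAt)
      (fun x hx ↦ (hd x (by simpa using hx)).differentiableAt.differentiableWithinAt) ?_
    intro x hx
    have hx : 0 < x := by simpa using hx
    rw [(hd x hx).deriv]
    refine mul_nonneg hδ0.le ?_
    have hA : 0 < (x + 2) ^ (δ - 1) := by positivity
    have hB : 0 < x ^ (δ - 1) := by positivity
    have hC : ((x + 1) ^ (δ - 1)) ^ 2 ≤ (x + 2) ^ (δ - 1) * x ^ (δ - 1) := by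
      rw [sq, ← mul_rpow (by positivity) (by positivity), ← mul_rpow (by positivity) hx.le]
      exact rpow_le_rpow_of_nonpos (by positivity) (by nlinarith) (by linarith)
    -- the arithmetic mean of the outer values dominates their geometric mean
    have hAB : 2 * (x + 1) ^ (δ - 1) ≤ (x + 2) ^ (δ - 1) + x ^ (δ - 1) := by
      refine le_of_sq_le_sq ?_ (by positivity)
      nlinarith [sq_nonneg ((x + 2) ^ (δ - 1) - x ^ (δ - 1))]
    linarith
  have h := hmono (a := (k : ℝ) + 1 / 2) (b := (k : ℝ) + 3 / 2) (mem_Ioi.2 (by positivity))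
    (mem_Ioi.2 (by positivity)) (by linarith)
  simp only [s]
  push_cast
  simp only [F] at h
  ring_nf at h ⊢
  exact h

/-- The tail of `q` has constant sign and telescoping, bounded partial sums. -/
lemma summable_q {δ : ℝ} (hδ0 : 0 < δ) (hδ1 : δ < 1) : Summable (q δ) := by
  rw [← summable_nat_add_iff 3, ← summable_neg_iff]
  refine summable_of_sum_range_le (c := -s δ 2) (fun k ↦ ?_) (fun n ↦ ?_)
  · have := s_le_s_succ hδ0 hδ1 k
    simp only [q]
    linarith
  · have h := Finset.sum_range_sub (fun k ↦ s δ (k + 2)) n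
    have h' := s_nonpos hδ0 hδ1 n
    calc ∑ i ∈ Finset.range n, -q δ (i + 3)
        = ∑ i ∈ Finset.range n, (s δ (i + 1 + 2) - s δ (i + 2)) := by
          refine Finset.sum_congr rfl fun i _ ↦ ?_
          simp only [q]
          ring_nf
      _ ≤ -s δ 2 := by
          rw [h]
          simp only [zero_add]
          linarith

/-- Inside the unit disc the power series of `q` is `-(1 - z) ^ 3` times that of
`(k + 1 / 2) ^ δ`. -/
lemma tsum_q_mul_pow {δ : ℝ} {z : ℂ}
    (h : Summable fun k : ℕ ↦ (((k + 1 / 2 : ℝ) ^ δ : ℝ) : ℂ) * z ^ k) :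
    ∑' k, (q δ k : ℂ) * z ^ k =
      -(1 - z) ^ 3 * ∑' k : ℕ, (((k + 1 / 2 : ℝ) ^ δ : ℝ) : ℂ) * z ^ k := by
  have h3 := h.hasSum.bdiff.bdiff.bdiff.neg
  simp_rw [← neg_mul, ← Complex.ofReal_neg, ← q_eq_neg_bdiff] at h3
  rw [h3.tsum_eq]
  ring

/-- The index `k : ℤ` of the Fourier coefficient corresponds to `q_{k+1}`. -/
lemma isGeneratingFunction_g {δ : ℝ} (hδ0 : 0 < δ) (hδ1 : δ < 1) :
    IsGeneratingFunction (T δ) (g δ) := by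
  refine ⟨fun k ↦ if 0 ≤ k + 1 then q δ (k + 1).toNat else 0, fun n i j ↦ ?_, fun θ ↦ ?_⟩
  · simp only [T, Matrix.of_apply]
    split_ifs <;> first | omega | rfl | skip
    congr 1
    omega
  · have hsum : HasSum (fun j : ℕ ↦ (q δ j : ℂ) * Complex.exp (Complex.I * ((j : ℂ) - 1) * θ))
        (g δ θ) := by
      refine Summable.hasSum (Summable.of_norm_bounded (summable_q hδ0 hδ1).norm fun j ↦ ?_)
      rw [norm_mul, Complex.norm_real, Complex.norm_exp]
      simp
    have hinj : Function.Injective (fun j : ℕ ↦ (j : ℤ) - 1) := fun a b h ↦ by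
      simpa using h
    refine (hinj.hasSum_iff fun k hk ↦ ?_).1 ?_
    · have : ¬ 0 ≤ k + 1 := fun h ↦ hk ⟨(k + 1).toNat, by simp; omega⟩
      simp [this]
    · convert hsum using 2 with j
      simp

lemma g_add_two_pi_mul_int (δ θ : ℝ) (m : ℤ) : g δ (θ + m * (2 * π)) = g δ θ := by
  unfold g
  congr 1 with j
  congr 1
  rw [Complex.exp_eq_exp_iff_exists_int]
  refine ⟨(j - 1) * m, ?_⟩
  push_cast
  ring

end FVToeplitz

/-! ### Poisson summation and the dual series -/

namespace FVToeplitz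

/-- The truncated power `x₊ ^ δ` damped by `exp (-w x)`. -/
noncomputable def dampedPow (δ : ℝ) (w : ℂ) (x : ℝ) : ℂ :=
  ((max x 0 ^ δ : ℝ) : ℂ) * Complex.exp (-w * x)

lemma continuous_dampedPow {δ : ℝ} (hδ : 0 < δ) (w : ℂ) : Continuous (dampedPow δ w) := by
  have : Continuous fun x : ℝ ↦ max x 0 ^ δ :=
    (continuous_id.max continuous_const).rpow_const fun _ ↦ Or.inr hδ.le
  unfold dampedPow
  fun_prop

lemma dampedPow_of_nonpos {δ : ℝ} (hδ : 0 < δ) (w : ℂ) {x : ℝ} (hx : x ≤ 0) :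
    dampedPow δ w x = 0 := by
  simp [dampedPow, max_eq_right hx, zero_rpow hδ.ne']

lemma dampedPow_of_nonneg (δ : ℝ) (w : ℂ) {x : ℝ} (hx : 0 ≤ x) :
    dampedPow δ w x = ((x ^ δ : ℝ) : ℂ) * Complex.exp (-w * x) := by
  rw [dampedPow, max_eq_left hx]

lemma dampedPow_isBigO_atTop (δ : ℝ) {w : ℂ} (hw : 0 < w.re) :
    dampedPow δ w =O[atTop] fun x ↦ |x| ^ (-2 : ℝ) := by
  have h := (Asymptotics.isBigO_refl (fun x : ℝ ↦ x ^ δ) atTop).mul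
    (isLittleO_exp_neg_mul_rpow_atTop hw (-2 - δ)).isBigO
  refine Asymptotics.IsBigO.congr' (Asymptotics.IsBigO.of_norm_left ?_)
    EventuallyEq.rfl EventuallyEq.rfl
  refine h.congr' ?_ ?_
  · filter_upwards [eventually_ge_atTop 0] with x hx
    rw [dampedPow_of_nonneg δ w hx, norm_mul, Complex.norm_real, Complex.norm_exp,
      Real.norm_of_nonneg (by positivity)]
    simp
  · filter_upwards [eventually_gt_atTop 0] with x hx
    rw [← rpow_add hx, abs_of_pos hx]
    ring_nf

lemma dampedPow_isBigO_cocompact {δ : ℝ} (hδ : 0 < δ) {w : ℂ} (hw : 0 < w.re) :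
    dampedPow δ w =O[cocompact ℝ] fun x ↦ |x| ^ (-2 : ℝ) := by
  rw [cocompact_eq_atBot_atTop, Asymptotics.isBigO_sup]
  refine ⟨?_, dampedPow_isBigO_atTop δ hw⟩
  refine (Asymptotics.isBigO_zero (E' := ℂ) (fun x : ℝ ↦ |x| ^ (-2 : ℝ)) atBot).congr' ?_
    EventuallyEq.rfl
  filter_upwards [eventually_le_atBot 0] with x hx
  exact (dampedPow_of_nonpos hδ w hx).symm

lemma fourier_dampedPow {δ : ℝ} (hδ : 0 < δ) {w : ℂ} (hw : 0 < w.re) (y : ℝ) :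
    𝓕 (dampedPow δ w) y =
      (w + 2 * π * y * Complex.I) ^ ((-1 - δ : ℝ) : ℂ) * Real.Gamma (δ + 1) := by
  have hw' : 0 < (w + 2 * π * y * Complex.I).re := by simpa using hw
  rw [Real.fourier_real_eq_integral_exp_smul, ← integral_rpow_mul_exp_neg_mul (by linarith) hw',
    ← setIntegral_eq_integral_of_forall_compl_eq_zero (s := Ioi 0)]
  · refine setIntegral_congr_fun measurableSet_Ioi fun x hx ↦ ?_
    simp only [dampedPow_of_nonneg δ w (le_of_lt hx), smul_eq_mul]
    rw [mul_left_comm, ← Complex.exp_add]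
    push_cast
    ring_nf
  · intro x hx
    rw [dampedPow_of_nonpos hδ w (not_lt.1 hx), smul_zero]

lemma summable_dampedPow_nat (δ : ℝ) {w : ℂ} (hw : 0 < w.re) :
    Summable fun k : ℕ ↦ dampedPow δ w (k + 1 / 2) := by
  have ht : Tendsto (fun k : ℕ ↦ (k : ℝ) + 1 / 2) atTop atTop :=
    tendsto_atTop_add_const_right _ _ tendsto_natCast_atTop_atTop
  have h := (dampedPow_isBigO_atTop δ hw).comp_tendsto ht
  refine summable_of_isBigO_nat ?_ h
  refine ((Real.summable_one_div_nat_add_rpow (1 / 2) 2).2 one_lt_two).congr fun k ↦ ?_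
  simp only [Function.comp_apply]
  rw [rpow_neg (abs_nonneg _), one_div]

lemma norm_cpow_le_abs_im_rpow {δ : ℝ} (hδ : 0 < δ) {w : ℂ} (hw : w.im ≠ 0) :
    ‖w ^ ((-1 - δ : ℝ) : ℂ)‖ ≤ |w.im| ^ (-1 - δ) := by
  rw [Complex.norm_cpow_real]
  exact rpow_le_rpow_of_nonpos (abs_pos.2 hw) (Complex.abs_im_le_norm w) (by linarith)

lemma summable_abs_add_two_pi_mul_rpow {δ : ℝ} (hδ : 0 < δ) (φ : ℝ) :
    Summable fun n : ℤ ↦ |φ + 2 * π * n| ^ (-1 - δ) := by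
  refine (((Real.summable_one_div_int_add_rpow (φ / (2 * π)) (1 + δ)).2 (by linarith)).mul_left
    ((2 * π) ^ (-1 - δ))).congr fun n ↦ ?_
  rw [show φ + 2 * π * n = 2 * π * (n + φ / (2 * π)) by field_simp; ring, abs_mul,
    mul_rpow (abs_nonneg _) (abs_nonneg _), abs_of_pos two_pi_pos,
    show -1 - δ = -(1 + δ) by ring, rpow_neg (abs_nonneg _), one_div]

/-- Poisson summation for the damped truncated power, evaluated at the half-integers. The
hypothesis `him` keeps the majorant `|Im w + 2πn| ^ (-1 - δ)` of the dual series away from the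
junk value of a negative power of zero. -/
lemma tsum_dampedPow {δ : ℝ} (hδ : 0 < δ) {w : ℂ} (hw : 0 < w.re)
    (him : ∀ n : ℤ, w.im + 2 * π * n ≠ 0) :
    ∑' k : ℕ, dampedPow δ w (k + 1 / 2) =
      Real.Gamma (δ + 1) *
        ∑' n : ℤ, (-1 : ℂ) ^ n * (w + 2 * π * n * Complex.I) ^ ((-1 - δ : ℝ) : ℂ) := by
  have hs : Summable fun n : ℤ ↦ 𝓕 (dampedPow δ w) n := by
    refine Summable.of_norm_bounded
      ((summable_abs_add_two_pi_mul_rpow hδ w.im).mul_right (Real.Gamma (δ + 1))) fun n ↦ ?_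
    rw [fourier_dampedPow hδ hw, norm_mul, Complex.norm_real,
      Real.norm_of_nonneg (Gamma_pos_of_pos (by linarith)).le]
    have h := norm_cpow_le_abs_im_rpow hδ (w := w + 2 * π * n * Complex.I) (by simpa using him n)
    refine mul_le_mul_of_nonneg_right ?_ (Gamma_pos_of_pos (by linarith)).le
    simpa using h
  have hP := Real.tsum_eq_tsum_fourier_of_rpow_decay_of_summable (continuous_dampedPow hδ w)
    one_lt_two (dampedPow_isBigO_cocompact hδ hw) hs (1 / 2)
  have hL : ∑' n : ℤ, dampedPow δ w (1 / 2 + n) = ∑' k : ℕ, dampedPow δ w (k + 1 / 2) := by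
    rw [← Function.Injective.tsum_eq Nat.cast_injective]
    · simp [add_comm]
    · intro n hn
      by_contra hneg
      refine hn (dampedPow_of_nonpos hδ w ?_)
      have : n ≤ -1 := by
        by_contra h
        exact hneg ⟨n.toNat, by simp; omega⟩
      have : (n : ℝ) ≤ -1 := by exact_mod_cast this
      linarith
  rw [← hL, hP, ← tsum_mul_left]
  congr 1 with n
  have hexp : fourier n ((1 / 2 : ℝ) : UnitAddCircle) = (-1 : ℂ) ^ n := by
    rw [fourier_coe_apply, ← Complex.exp_pi_mul_I, ← Complex.exp_int_mul]
    congr 1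
    push_cast
    ring
  rw [fourier_dampedPow hδ hw, hexp]
  push_cast
  ring

/-- The alternating series `∑ (-1) ^ m (y + 2 π m) ^ (-1 - δ)`. -/
noncomputable def altSum (δ y : ℝ) : ℝ := ∑' m : ℕ, (-1) ^ m * (y + 2 * π * m) ^ (-1 - δ)

lemma summable_altSum {δ : ℝ} (hδ : 0 < δ) {y : ℝ} (hy : 0 < y) :
    Summable fun m : ℕ ↦ (-1) ^ m * (y + 2 * π * m) ^ (-1 - δ) := by
  have h := (summable_abs_add_two_pi_mul_rpow hδ y).comp_injective Nat.cast_injective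
  refine Summable.of_norm_bounded h fun m ↦ ?_
  have : 0 < y + 2 * π * m := by positivity
  simp [abs_of_pos this, abs_of_pos (rpow_pos_of_pos this (-1 - δ))]

lemma altSum_pos {δ : ℝ} (hδ : 0 < δ) {y : ℝ} (hy : 0 < y) : 0 < altSum δ y := by
  have hanti : Antitone fun m : ℕ ↦ (y + 2 * π * m) ^ (-1 - δ) := by
    intro a b hab
    refine rpow_le_rpow_of_nonpos (by positivity) ?_ (by linarith)
    gcongr
  have h := hanti.alternating_series_le_tendsto (summable_altSum hδ hy).hasSum.tendsto_sum_nat 1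
  refine lt_of_lt_of_le ?_ h
  have := rpow_lt_rpow_of_neg hy (show y < y + 2 * π by linarith [pi_pos])
    (show -1 - δ < 0 by linarith)
  simpa [Finset.sum_range_succ] using this

lemma ofReal_mul_I_cpow (δ : ℝ) {y : ℝ} (hy : 0 < y) :
    ((y : ℂ) * Complex.I) ^ ((-1 - δ : ℝ) : ℂ) =
      ((y ^ (-1 - δ) : ℝ) : ℂ) * (-Complex.I * Complex.exp (-(π * δ / 2 : ℝ) * Complex.I)) := by
  rw [Complex.cpow_def_of_ne_zero (by simp [hy.ne']), Complex.log_ofReal_mul hy Complex.I_ne_zero,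
    Complex.log_I, rpow_def_of_pos hy, ← Complex.exp_neg_pi_div_two_mul_I]
  push_cast
  simp only [← Complex.exp_add]
  congr 1
  ring

lemma neg_ofReal_mul_I_cpow (δ : ℝ) {y : ℝ} (hy : 0 < y) :
    (((-y : ℝ) : ℂ) * Complex.I) ^ ((-1 - δ : ℝ) : ℂ) =
      ((y ^ (-1 - δ) : ℝ) : ℂ) * (Complex.I * Complex.exp ((π * δ / 2 : ℝ) * Complex.I)) := by
  rw [show ((-y : ℝ) : ℂ) * Complex.I = y * (-Complex.I) by push_cast; ring,
    Complex.cpow_def_of_ne_zero (by simp [hy.ne']),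
    Complex.log_ofReal_mul hy (neg_ne_zero.2 Complex.I_ne_zero),
    Complex.log_neg_I, rpow_def_of_pos hy,
    show Complex.I * Complex.exp ((π * δ / 2 : ℝ) * Complex.I) =
      Complex.exp (π / 2 * Complex.I) * Complex.exp ((π * δ / 2 : ℝ) * Complex.I) by
        rw [Complex.exp_pi_div_two_mul_I]]
  push_cast
  simp only [← Complex.exp_add]
  congr 1
  ring

/-- On the imaginary axis the Poisson dual series splits into two alternating series, from
`n ≥ 0` and from `n < 0`. -/
lemma tsum_int_cpow {δ φ : ℝ} (hδ : 0 < δ) (h0 : 0 < φ) (h1 : φ < 2 * π) :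
    ∑' n : ℤ, (-1 : ℂ) ^ n * (φ * Complex.I + 2 * π * n * Complex.I) ^ ((-1 - δ : ℝ) : ℂ) =
      -Complex.I * (altSum δ φ * Complex.exp (-(π * δ / 2 : ℝ) * Complex.I) +
        altSum δ (2 * π - φ) * Complex.exp ((π * δ / 2 : ℝ) * Complex.I)) := by
  have hpos := Complex.hasSum_ofReal.2 (summable_altSum hδ h0).hasSum
  have hneg := Complex.hasSum_ofReal.2 (summable_altSum hδ (sub_pos.2 h1)).hasSum
  have hA := hpos.mul_right (-Complex.I * Complex.exp (-(π * δ / 2 : ℝ) * Complex.I))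
  have hB := hneg.mul_right (-Complex.I * Complex.exp ((π * δ / 2 : ℝ) * Complex.I))
  have eA (m : ℕ) : (((-1) ^ m * (φ + 2 * π * m) ^ (-1 - δ) : ℝ) : ℂ) *
      (-Complex.I * Complex.exp (-(π * δ / 2 : ℝ) * Complex.I)) = (-1 : ℂ) ^ (m : ℤ) *
      (φ * Complex.I + 2 * π * ((m : ℤ) : ℂ) * Complex.I) ^ ((-1 - δ : ℝ) : ℂ) := by
    have hy : 0 < φ + 2 * π * m := by positivity
    rw [show (φ : ℂ) * Complex.I + 2 * π * ((m : ℤ) : ℂ) * Complex.I =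
      ((φ + 2 * π * m : ℝ) : ℂ) * Complex.I by push_cast; ring, ofReal_mul_I_cpow δ hy,
      zpow_natCast]
    push_cast
    ring
  have eB (m : ℕ) : (((-1) ^ m * (2 * π - φ + 2 * π * m) ^ (-1 - δ) : ℝ) : ℂ) *
      (-Complex.I * Complex.exp ((π * δ / 2 : ℝ) * Complex.I)) = (-1 : ℂ) ^ (-((m : ℤ) + 1)) *
      (φ * Complex.I + 2 * π * ((-((m : ℤ) + 1) : ℤ) : ℂ) * Complex.I) ^ ((-1 - δ : ℝ) : ℂ) := by
    have hy : 0 < 2 * π - φ + 2 * π * m := by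
      have := sub_pos.2 h1
      positivity
    rw [show (φ : ℂ) * Complex.I + 2 * π * ((-((m : ℤ) + 1) : ℤ) : ℂ) * Complex.I =
      ((-(2 * π - φ + 2 * π * m) : ℝ) : ℂ) * Complex.I by push_cast; ring,
      neg_ofReal_mul_I_cpow δ hy, zpow_neg, ← inv_zpow, inv_neg_one,
      zpow_add_one₀ (by norm_num), zpow_natCast]
    push_cast
    ring
  -- `eA` gives the terms of index `n = m`, `eB` those of index `n = -(m + 1)`
  rw [funext eA] at hA
  rw [funext eB] at hB
  have hS := HasSum.of_nat_of_neg_add_one (f := fun n : ℤ ↦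
    (-1 : ℂ) ^ n * (φ * Complex.I + 2 * π * n * Complex.I) ^ ((-1 - δ : ℝ) : ℂ)) hA hB
  rw [hS.tsum_eq]
  simp only [altSum]
  ring


end FVToeplitz

/-! ### Closed form of the generating function -/

namespace FVToeplitz

/-- For `Re w > 0` the power series of `q` at `exp (-w)` is given by the Poisson dual series. -/
lemma tsum_q_mul_exp {δ : ℝ} (hδ : 0 < δ) {w : ℂ} (hw : 0 < w.re)
    (him : ∀ n : ℤ, w.im + 2 * π * n ≠ 0) :
    ∑' k : ℕ, (q δ k : ℂ) * Complex.exp (-w) ^ k =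
      -(1 - Complex.exp (-w)) ^ 3 * (Complex.exp (w / 2) * (Real.Gamma (δ + 1) *
        ∑' n : ℤ, (-1 : ℂ) ^ n * (w + 2 * π * n * Complex.I) ^ ((-1 - δ : ℝ) : ℂ))) := by
  have hterm (k : ℕ) : (((k + 1 / 2 : ℝ) ^ δ : ℝ) : ℂ) * Complex.exp (-w) ^ k =
      Complex.exp (w / 2) * dampedPow δ w (k + 1 / 2) := by
    rw [dampedPow_of_nonneg δ w (by positivity), mul_left_comm, ← Complex.exp_nat_mul,
      ← Complex.exp_add]
    push_cast
    ring_nf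
  rw [← tsum_dampedPow hδ hw him, ← tsum_mul_left, tsum_q_mul_pow]
  · simp_rw [hterm]
  · exact ((summable_dampedPow_nat δ hw).mul_left _).congr fun k ↦ (hterm k).symm

lemma add_two_pi_mul_int_ne_zero {φ : ℝ} (h0 : 0 < φ) (h1 : φ < 2 * π) (n : ℤ) :
    φ + 2 * π * n ≠ 0 := by
  intro h
  have hl : (-1 : ℝ) < n := by nlinarith [pi_pos]
  have hu : (n : ℝ) < 0 := by nlinarith [pi_pos]
  have hl' : (-1 : ℤ) < n := by exact_mod_cast hl
  have hu' : n < 0 := by exact_mod_cast hu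
  omega

/-- The identity `tsum_q_mul_exp` persists on the imaginary axis away from `2πℤ`: both sides are
continuous up to the boundary by dominated convergence. -/
lemma tsum_q_mul_exp_boundary {δ φ : ℝ} (hδ0 : 0 < δ) (hδ1 : δ < 1) (h0 : 0 < φ)
    (h1 : φ < 2 * π) :
    ∑' k : ℕ, (q δ k : ℂ) * Complex.exp (-(φ * Complex.I)) ^ k =
      -(1 - Complex.exp (-(φ * Complex.I))) ^ 3 *
        (Complex.exp (φ * Complex.I / 2) * (Real.Gamma (δ + 1) *
        ∑' n : ℤ, (-1 : ℂ) ^ n *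
          (φ * Complex.I + 2 * π * n * Complex.I) ^ ((-1 - δ : ℝ) : ℂ))) := by
  have hne := add_two_pi_mul_int_ne_zero h0 h1
  have hw : Tendsto (fun ε : ℝ ↦ (ε : ℂ) + φ * Complex.I) (𝓝[>] 0) (𝓝 (φ * Complex.I)) := by
    have : Continuous fun ε : ℝ ↦ (ε : ℂ) + φ * Complex.I := by fun_prop
    exact (this.tendsto' 0 _ (by simp)).mono_left nhdsWithin_le_nhds
  have hz : Tendsto (fun ε : ℝ ↦ Complex.exp (-((ε : ℂ) + φ * Complex.I))) (𝓝[>] 0)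
      (𝓝 (Complex.exp (-(φ * Complex.I)))) :=
    (Complex.continuous_exp.tendsto _).comp hw.neg
  have hL : Tendsto (fun ε : ℝ ↦
      ∑' k : ℕ, (q δ k : ℂ) * Complex.exp (-((ε : ℂ) + φ * Complex.I)) ^ k) (𝓝[>] 0)
      (𝓝 (∑' k : ℕ, (q δ k : ℂ) * Complex.exp (-(φ * Complex.I)) ^ k)) := by
    refine tendsto_tsum_of_dominated_convergence (summable_q hδ0 hδ1).norm
      (fun k ↦ (hz.pow k).const_mul _) ?_
    filter_upwards [self_mem_nhdsWithin] with ε hε k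
    rw [norm_mul, Complex.norm_real, norm_pow, Complex.norm_exp]
    refine mul_le_of_le_one_right (norm_nonneg _) (pow_le_one₀ (exp_pos _).le ?_)
    simpa using (mem_Ioi.1 hε).le
  have hS : Tendsto (fun ε : ℝ ↦ ∑' n : ℤ, (-1 : ℂ) ^ n *
      ((ε : ℂ) + φ * Complex.I + 2 * π * n * Complex.I) ^ ((-1 - δ : ℝ) : ℂ)) (𝓝[>] 0)
      (𝓝 (∑' n : ℤ, (-1 : ℂ) ^ n *
        (φ * Complex.I + 2 * π * n * Complex.I) ^ ((-1 - δ : ℝ) : ℂ))) := by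
    refine tendsto_tsum_of_dominated_convergence (summable_abs_add_two_pi_mul_rpow hδ0 φ)
      (fun n ↦ Tendsto.const_mul _ ?_) (.of_forall fun ε n ↦ ?_)
    · refine (continuousAt_cpow_const ?_).tendsto.comp (hw.add_const _)
      exact Or.inr (by simpa using hne n)
    · rw [norm_mul, norm_zpow, norm_neg, norm_one, one_zpow, one_mul]
      have h := norm_cpow_le_abs_im_rpow hδ0
        (w := (ε : ℂ) + φ * Complex.I + 2 * π * n * Complex.I) (by simpa using hne n)
      simpa using h
  have hR := ((hz.const_sub 1).pow 3).neg.mul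
    (((Complex.continuous_exp.tendsto _).comp (hw.div_const 2)).mul
      (hS.const_mul (Real.Gamma (δ + 1) : ℂ)))
  refine tendsto_nhds_unique (hL.congr' ?_) hR
  filter_upwards [self_mem_nhdsWithin] with ε hε
  exact tsum_q_mul_exp hδ0 (by simpa using hε) (by simpa using hne)

/-- Closed form of the generating function on a period: a positive combination of the two unit
vectors `exp (∓ i π δ / 2)`. -/
lemma g_neg_eq {δ φ : ℝ} (hδ0 : 0 < δ) (hδ1 : δ < 1) (h0 : 0 < φ) (h1 : φ < 2 * π) :
    g δ (-φ) = ((8 * sin (φ / 2) ^ 3 * Real.Gamma (δ + 1) : ℝ) : ℂ) *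
      (altSum δ φ * Complex.exp (-(π * δ / 2 : ℝ) * Complex.I) +
        altSum δ (2 * π - φ) * Complex.exp ((π * δ / 2 : ℝ) * Complex.I)) := by
  have hg : g δ (-φ) = Complex.exp (φ * Complex.I) *
      ∑' k : ℕ, (q δ k : ℂ) * Complex.exp (-(φ * Complex.I)) ^ k := by
    rw [g, ← tsum_mul_left]
    congr 1 with k
    rw [mul_left_comm, ← Complex.exp_nat_mul, ← Complex.exp_add]
    push_cast
    ring_nf
  -- `-(1 - z) ^ 3 z ^ (-3 / 2)` is `-(2i sin (φ / 2)) ^ 3` for `z = exp (-iφ)`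
  have hsin : -Complex.I * (-(1 - Complex.exp (-(φ * Complex.I))) ^ 3 *
      (Complex.exp (φ * Complex.I) * Complex.exp (φ * Complex.I / 2))) =
      8 * Complex.sin (φ / 2) ^ 3 := by
    set u := Complex.exp (φ * Complex.I / 2) with hu
    have hu0 : u ≠ 0 := Complex.exp_ne_zero _
    have hinv : Complex.exp (-(φ / 2) * Complex.I) = u⁻¹ := by
      rw [hu, ← Complex.exp_neg]; ring_nf
    have hsq : Complex.exp (φ * Complex.I) = u ^ 2 := by
      rw [hu, ← Complex.exp_nat_mul]; push_cast; ring_nf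
    have hs : Complex.sin (φ / 2) = (u⁻¹ - u) * Complex.I / 2 := by
      rw [Complex.sin, hinv, hu]; ring_nf
    rw [hs, Complex.exp_neg, hsq, div_pow, mul_pow, Complex.I_pow_three]
    field_simp
    ring
  rw [hg, tsum_q_mul_exp_boundary hδ0 hδ1 h0 h1, tsum_int_cpow hδ0 h0 h1]
  push_cast
  rw [← hsin]
  ring

lemma g_neg_re_im {δ φ : ℝ} (hδ0 : 0 < δ) (hδ1 : δ < 1) (h0 : 0 < φ) (h1 : φ < 2 * π) :
    (g δ (-φ)).re = 8 * sin (φ / 2) ^ 3 * Real.Gamma (δ + 1) *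
        (cos (δ / 2 * π) * (altSum δ φ + altSum δ (2 * π - φ))) ∧
    (g δ (-φ)).im = 8 * sin (φ / 2) ^ 3 * Real.Gamma (δ + 1) *
        (sin (δ / 2 * π) * (altSum δ (2 * π - φ) - altSum δ φ)) := by
  rw [g_neg_eq hδ0 hδ1 h0 h1, ← Complex.ofReal_neg, show δ / 2 * π = π * δ / 2 by ring]
  constructor
  · rw [Complex.re_ofReal_mul, Complex.add_re, Complex.re_ofReal_mul, Complex.re_ofReal_mul,
      Complex.exp_ofReal_mul_I_re, Complex.exp_ofReal_mul_I_re, cos_neg]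
    ring
  · rw [Complex.im_ofReal_mul, Complex.add_im, Complex.im_ofReal_mul, Complex.im_ofReal_mul,
      Complex.exp_ofReal_mul_I_im, Complex.exp_ofReal_mul_I_im, sin_neg]
    ring

/-- Reduction modulo `2π`; the endpoint of the period is excluded by `hθ`. -/
lemma exists_neg_add_two_pi_mul_int {θ : ℝ} (hθ : ∀ k : ℤ, θ ≠ 2 * (k : ℝ) * π) :
    ∃ (φ : ℝ) (m : ℤ), 0 < φ ∧ φ < 2 * π ∧ θ = -φ + m * (2 * π) := by
  have hlt : (⌊-θ / (2 * π)⌋ : ℝ) * (2 * π) < -θ := by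
    refine lt_of_le_of_ne ((le_div_iff₀ two_pi_pos).1 (Int.floor_le _)) fun h ↦ ?_
    refine hθ (-⌊-θ / (2 * π)⌋) ?_
    push_cast
    linarith
  have hgt := (div_lt_iff₀ two_pi_pos).1 (Int.lt_floor_add_one (-θ / (2 * π)))
  refine ⟨-θ - ⌊-θ / (2 * π)⌋ * (2 * π), -⌊-θ / (2 * π)⌋, by linarith, by linarith, ?_⟩
  push_cast
  ring

end FVToeplitz

theorem lemma3p8 (δ : ℝ) (hδ0 : 0 < δ) (hδ1 : δ < 1) :
    FVToeplitz.IsGeneratingFunction (FVToeplitz.T δ) (FVToeplitz.g δ) ∧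
    ∀ θ : ℝ, (∀ k : ℤ, θ ≠ 2 * (k : ℝ) * Real.pi) →
      0 < (FVToeplitz.g δ θ).re ∧
      |(FVToeplitz.g δ θ).im| / (FVToeplitz.g δ θ).re < Real.tan (δ / 2 * Real.pi) := by
  refine ⟨FVToeplitz.isGeneratingFunction_g hδ0 hδ1, fun θ hθ ↦ ?_⟩
  obtain ⟨φ, m, h0, h1, rfl⟩ := FVToeplitz.exists_neg_add_two_pi_mul_int hθ
  rw [FVToeplitz.g_add_two_pi_mul_int]
  obtain ⟨hre, him⟩ := FVToeplitz.g_neg_re_im hδ0 hδ1 h0 h1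
  have hA := FVToeplitz.altSum_pos hδ0 h0
  have hB := FVToeplitz.altSum_pos hδ0 (sub_pos.2 h1)
  have hc : 0 < cos (δ / 2 * π) :=
    cos_pos_of_mem_Ioo ⟨by nlinarith [pi_pos], by nlinarith [pi_pos]⟩
  have hs : 0 < sin (δ / 2 * π) := sin_pos_of_pos_of_lt_pi (by positivity) (by nlinarith [pi_pos])
  have hK : 0 < 8 * sin (φ / 2) ^ 3 * Real.Gamma (δ + 1) := by
    have := sin_pos_of_pos_of_lt_pi (x := φ / 2) (by positivity) (by linarith)
    have := Gamma_pos_of_pos (s := δ + 1) (by linarith)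
    positivity
  have hpos : 0 < (FVToeplitz.g δ (-φ)).re := by
    rw [hre]
    positivity
  refine ⟨hpos, ?_⟩
  have hAB : |FVToeplitz.altSum δ (2 * π - φ) - FVToeplitz.altSum δ φ| <
      FVToeplitz.altSum δ φ + FVToeplitz.altSum δ (2 * π - φ) :=
    abs_lt.2 ⟨by linarith, by linarith⟩
  rw [div_lt_iff₀ hpos, him, hre,
    abs_mul (8 * sin (φ / 2) ^ 3 * Real.Gamma (δ + 1)), abs_of_pos hK, abs_mul, abs_of_pos hs,
    tan_eq_sin_div_cos]
  calc _ < 8 * sin (φ / 2) ^ 3 * Real.Gamma (δ + 1) * (sin (δ / 2 * π) *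
        (FVToeplitz.altSum δ φ + FVToeplitz.altSum δ (2 * π - φ))) := by gcongr
    _ = _ := by
      rw [div_mul_eq_mul_div (sin (δ / 2 * π)), eq_div_iff hc.ne']
      ring
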